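/- Let $\mathcal H$ and $\mathcal G$ be real Hilbert spaces, let $A\colon\mathcal H\to 2^{\mathcal H}$ and $B\colon\mathcal G\to 2^{\mathcal G}$ be set-valued operators, and let $L\colon\mathcal H\to\mathcal G$ be a bounded linear operator with adjoint $L^*$. For a set-valued operator $T$, let $\operatorname{ran}T=\bigcup_x Tx$, let $\operatorname{gra}T=\{(x,u) : u\in Tx\}$, and let $T^{-1}$ be the set-valued operator given by $x\in T^{-1}u\Leftrightarrow u\in Tx$; sums of set-valued operators are taken pointwise in the sense of Minkowski, and $(L\circ T\circ L^*)v=L\big(T(L^*v)\big)$. The parallel composition of $A$ by $L$ is $L\triangleright A=(L\circ A^{-1}\circ L^*)^{-1}\colon\mathcal G\to 2^{\mathcal G}$, and the parallel sum of two operators $S,T\colon\mathcal G\to 2^{\mathcal G}$ is $S\,\square\,T=(S^{-1}+T^{-1})^{-1}$. An operator $T$ is monotone if $\langle x-y,u-v\rangle\ge 0$ for all $x,y$ and all $u\in Tx$, $v\in Ty$; it is maximally monotone if it is monotone and there is no monotone operator whose graph strictly contains $\operatorname{gra}T$. The cone generated by a set $C$ is $\{t x : t>0,\ x\in C\}$.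 Then the following hold. 1. $((L\triangleright A)\,\square\,B)^{-1}=L\circ A^{-1}\circ L^*+B^{-1}$. 2. If $A$ and $B$ are monotone, then $(L\triangleright A)\,\square\,B$ is monotone. 3. If $A$ and $B$ are maximally monotone and the cone generated by $L^*(\operatorname{ran}B)-\operatorname{ran}A$ is a closed vector subspace of $\mathcal H$, then $(L\triangleright A)\,\square\,B$ is maximally monotone. 4. If $A$ is maximally monotone and the cone generated by $\operatorname{ran}L^*+\operatorname{ran}A$ is a closed vector subspace of $\mathcal H$, then $L\triangleright A$ is maximally monotone. -/

import Mathlib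

open scoped Pointwise

/-- Set-valued operators `A : E → 2^F` are functions `E → Set F`. -/
abbrev SetValued (E F : Type*) := E → Set F

namespace SetValued

/-- The range `{u | ∃ x, u ∈ A x}`. -/
def ran {E F : Type*} (A : SetValued E F) : Set F := {u | ∃ x, u ∈ A x}

/-- The graph `{(x, u) | u ∈ A x}`. -/
def gra {E F : Type*} (A : SetValued E F) : Set (E × F) := {p | p.2 ∈ A p.1}

/-- The inverse operator: `x ∈ A⁻¹ u` if and only if `u ∈ A x`. -/
def inv {E F : Type*} (A : SetValued E F) : SetValued F E := fun u => {x | u ∈ A x}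

/-- The sum `x ↦ A x + B x` (Minkowski sum of the values). -/
def sum {E F : Type*} [Add F] (A B : SetValued E F) : SetValued E F := fun x => A x + B x

/-- The composition `f ∘ A ∘ g` of a set-valued operator `A` with single-valued maps `f`, `g`:
it sends `x` to the image of the set `A (g x)` under `f`. -/
def comp {D E F K : Type*} (f : F → K) (A : SetValued E F) (g : D → E) : SetValued D K :=
  fun x => f '' A (g x)

/-- The parallel sum `A □ B = (A⁻¹ + B⁻¹)⁻¹`. -/
def parallelSum {E F : Type*} [Add E] (A B : SetValued E F) : SetValued E F :=
  inv (sum (inv A) (inv B))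

section Hilbert

variable {H G : Type*}
  [NormedAddCommGroup H] [InnerProductSpace ℝ H]
  [NormedAddCommGroup G] [InnerProductSpace ℝ G]

/-- The parallel composition `L ▷ A = (L ∘ A⁻¹ ∘ L*)⁻¹` of `A` by `L`. -/
noncomputable def parallelComp [CompleteSpace H] [CompleteSpace G]
    (L : H →L[ℝ] G) (A : SetValued H H) : SetValued G G :=
  inv (comp L (inv A) (ContinuousLinearMap.adjoint L))

/-- Monotonicity: `⟪x - y, u - v⟫ ≥ 0` whenever `u ∈ A x` and `v ∈ A y`. -/
def IsMonotone (A : SetValued H H) : Prop :=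
  ∀ x y : H, ∀ u ∈ A x, ∀ v ∈ A y, 0 ≤ inner ℝ (x - y) (u - v)

/-- Maximal monotonicity: `A` is monotone and no monotone operator has a strictly larger graph. -/
def IsMaximallyMonotone (A : SetValued H H) : Prop :=
  IsMonotone A ∧ ¬ ∃ B : SetValued H H, IsMonotone B ∧ gra A ⊆ gra B ∧ gra B ≠ gra A

/-- The cone generated by `C`: the set of all `t • x` with `t > 0` and `x ∈ C`, that is, the
smallest set containing `C` that is stable under multiplication by positive scalars. -/
def coneGenerated (C : Set H) : Set H := {y | ∃ t : ℝ, 0 < t ∧ ∃ x ∈ C, y = t • x}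

/-- The set `C` is a closed vector subspace. -/
def IsClosedSubspace (C : Set H) : Prop :=
  ∃ S : Submodule ℝ H, (S : Set H) = C ∧ IsClosed C

end Hilbert

end SetValued

namespace SetValued

/-! Inversion preserves (maximal) monotonicity, and the inverse of `(L ▷ A) □ B` is `L ∘ A⁻¹ ∘ L* +
B⁻¹` by definition. Everything thus reduces to the maximality of such a sum, hence to the
surjectivity of `Id` plus the sum, proved in `exists_add_add_adjoint_eq`. There the composed
operator is replaced by its Yosida regularization, which makes the inclusion solvable by Minty's
theorem and a contraction argument. The dual variables `v n` lie in the closed subspace generated by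
the cone condition and are pointwise bounded on it, hence bounded by Banach-Steinhaus. Comparing two
regularization indices shows that solutions form Cauchy sequences, and closedness of graphs gives
the limit inclusion. Minty's theorem itself comes from minimizing the Fitzpatrick function plus half
the squared norm. The last claim is the case `B⁻¹ = 0`. -/

/-- A sequence whose squared increments are dominated by the increments of a Cauchy sequence
is a Cauchy sequence. -/
theorem cauchySeq_of_sq_norm_sub_le {V X : Type*} [SeminormedAddCommGroup V] [PseudoMetricSpace X] {f : ℕ → V} {w : ℕ → X}
    {C : ℝ} (hw : CauchySeq w) (h : ∀ n m, ‖f n - f m‖ ^ 2 ≤ C * dist (w n) (w m)) :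
    CauchySeq f := by
  rw [Metric.cauchySeq_iff] at hw ⊢
  intro ε hε
  have hC : 0 < |C| + 1 := by positivity
  obtain ⟨N, hN⟩ := hw (ε ^ 2 / (|C| + 1)) (by positivity)
  refine ⟨N, fun m hm n hn => ?_⟩
  rw [dist_eq_norm]
  refine lt_of_pow_lt_pow_left₀ 2 hε.le ((h m n).trans_lt ?_)
  have h1 := hN m hm n hn
  rw [lt_div_iff₀ hC] at h1
  nlinarith [le_abs_self C, dist_nonneg (x := w m) (y := w n)]

/-! ### Elementary properties of maximally monotone operators. -/

section Operators

variable {E : Type*} [NormedAddCommGroup E] [InnerProductSpace ℝ E]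

/-- A point that is monotonically related to the graph of a maximally monotone operator lies
in this graph. -/
theorem IsMaximallyMonotone.mem_of_related {A : SetValued E E} (hA : IsMaximallyMonotone A)
    {x u : E} (h : ∀ a, ∀ b ∈ A a, 0 ≤ inner ℝ (x - a) (u - b)) : u ∈ A x := by
  by_contra hxu
  refine hA.2 ⟨fun a => {b | b ∈ A a ∨ (a = x ∧ b = u)}, ?_, ?_, ?_⟩
  · rintro a a' b (hb | ⟨rfl, rfl⟩) b' (hb' | ⟨rfl, rfl⟩)
    · exact hA.1 a a' b hb b' hb'
    · have := h a b hb
      rwa [← neg_sub a, ← neg_sub b, inner_neg_neg] at this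
    · exact h a' b' hb'
    · simp
  · intro p hp
    exact Or.inl hp
  · intro heq
    have : (x, u) ∈ gra A := heq ▸ (Or.inr ⟨rfl, rfl⟩ : u ∈ A x ∨ (x = x ∧ u = u))
    exact hxu this

theorem IsMonotone.isMaximallyMonotone {A : SetValued E E} (hA : IsMonotone A)
    (h : ∀ x u, (∀ a, ∀ b ∈ A a, 0 ≤ inner ℝ (x - a) (u - b)) → u ∈ A x) :
    IsMaximallyMonotone A := by
  refine ⟨hA, ?_⟩
  rintro ⟨B, hB, hAB, hne⟩
  refine hne (Set.Subset.antisymm ?_ hAB)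
  rintro ⟨x, u⟩ hxu
  exact h x u fun a b hb => hB x a u hxu b (hAB (show (a, b) ∈ gra A from hb))

theorem IsMonotone.inv {A : SetValued E E} (hA : IsMonotone A) : IsMonotone (inv A) := by
  intro x y u hu v hv
  rw [real_inner_comm]
  exact hA u v x hu y hv

theorem IsMaximallyMonotone.inv {A : SetValued E E} (hA : IsMaximallyMonotone A) :
    IsMaximallyMonotone (inv A) := by
  refine hA.1.inv.isMaximallyMonotone fun x u h => ?_
  refine hA.mem_of_related fun a b hb => ?_
  rw [real_inner_comm]
  exact h b a hb

theorem IsMaximallyMonotone.exists_mem {A : SetValued E E} (hA : IsMaximallyMonotone A) :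
    ∃ x, ∃ u, u ∈ A x := by
  by_contra! h
  exact h 0 0 (hA.mem_of_related fun a b hb => absurd hb (h a b))

theorem IsMaximallyMonotone.mem_of_tendsto {A : SetValued E E} (hA : IsMaximallyMonotone A)
    {x u : ℕ → E} {x₀ u₀ : E} (h : ∀ n, u n ∈ A (x n))
    (hx : Filter.Tendsto x Filter.atTop (nhds x₀))
    (hu : Filter.Tendsto u Filter.atTop (nhds u₀)) : u₀ ∈ A x₀ := by
  refine hA.mem_of_related fun a b hb => ?_
  refine ge_of_tendsto' ((hx.sub_const a).inner (hu.sub_const b)) fun n => ?_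
  exact hA.1 _ _ _ (h n) _ hb

/-- A monotone operator `A` such that `Id + A` is surjective is maximally monotone. -/
theorem IsMonotone.isMaximallyMonotone_of_surjective {A : SetValued E E} (hA : IsMonotone A)
    (h : ∀ z, ∃ x, ∃ u ∈ A x, x + u = z) : IsMaximallyMonotone A := by
  refine hA.isMaximallyMonotone fun x u hxu => ?_
  obtain ⟨a, b, hb, hab⟩ := h (x + u)
  have h1 := hxu a b hb
  have h2 : u - b = -(x - a) := by
    rw [← sub_eq_zero]
    calc u - b - -(x - a) = (x + u) - (a + b) := by abel
      _ = 0 := by rw [hab, sub_self]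
  rw [h2, inner_neg_right, real_inner_self_eq_norm_sq] at h1
  have h3 : x - a = 0 := by
    rw [← norm_eq_zero]
    nlinarith [norm_nonneg (x - a)]
  rw [h3, neg_zero] at h2
  rw [sub_eq_zero.1 h2, sub_eq_zero.1 h3]
  exact hb

theorem IsMonotone.sum {A B : SetValued E E} (hA : IsMonotone A) (hB : IsMonotone B) :
    IsMonotone (sum A B) := by
  rintro x y _ ⟨u, hu, v, hv, rfl⟩ _ ⟨u', hu', v', hv', rfl⟩
  change 0 ≤ inner ℝ (x - y) (u + v - (u' + v'))
  rw [add_sub_add_comm, inner_add_right]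
  exact add_nonneg (hA x y u hu u' hu') (hB x y v hv v' hv')

theorem isMaximallyMonotone_zero : IsMaximallyMonotone (fun _ : E => ({0} : Set E)) := by
  refine IsMonotone.isMaximallyMonotone_of_surjective ?_ fun z => ⟨z, 0, rfl, add_zero z⟩
  rintro x y _ rfl _ rfl
  simp

theorem coneGenerated_neg (C : Set E) : coneGenerated (-C) = -coneGenerated C := by
  ext y
  constructor
  · rintro ⟨t, ht, x, hx, rfl⟩
    exact ⟨t, ht, -x, hx, (smul_neg t x).symm⟩
  · rintro ⟨t, ht, x, hx, h⟩
    exact ⟨t, ht, -x, by simpa using hx, by rw [smul_neg, ← h, neg_neg]⟩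

theorem IsClosedSubspace.neg {C : Set E} (hC : IsClosedSubspace C) : IsClosedSubspace (-C) := by
  obtain ⟨S, rfl, hcl⟩ := hC
  exact ⟨S, by ext x; simp, hcl.neg⟩

/-- The lower bound `⟪x, u⟫` for the Fitzpatrick function of a maximally monotone operator. -/
theorem IsMaximallyMonotone.inner_le_of_fitzpatrick_le {A : SetValued E E}
    (hA : IsMaximallyMonotone A) {x u : E} {t : ℝ}
    (h : ∀ a, ∀ b ∈ A a, inner ℝ x b + inner ℝ a u - inner ℝ a b ≤ t) :
    inner ℝ x u ≤ t := by
  by_contra! hlt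
  have hxu : u ∈ A x := hA.mem_of_related fun a b hb => by
    have := h a b hb
    simp only [inner_sub_left, inner_sub_right]
    linarith
  have := h x u hxu
  linarith

/-! ### Minty's theorem and a forward-backward fixed point. -/

section Minty

variable [CompleteSpace E]

/-- The sum of the Fitzpatrick function and of half the squared norm attains its infimum. -/
theorem IsMaximallyMonotone.exists_minimizer {A : SetValued E E} (hA : IsMaximallyMonotone A) :
    ∃ (x₀ u₀ : E) (t₀ : ℝ),
      (∀ a, ∀ b ∈ A a, inner ℝ x₀ b + inner ℝ a u₀ - inner ℝ a b ≤ t₀) ∧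
      ∀ (x u : E) (t : ℝ),
        (∀ a, ∀ b ∈ A a, inner ℝ x b + inner ℝ a u - inner ℝ a b ≤ t) →
        t₀ + ‖x₀‖ ^ 2 / 2 + ‖u₀‖ ^ 2 / 2 ≤ t + ‖x‖ ^ 2 / 2 + ‖u‖ ^ 2 / 2 := by
  set P : E → E → ℝ → Prop := fun x u t =>
    ∀ a, ∀ b ∈ A a, inner ℝ x b + inner ℝ a u - inner ℝ a b ≤ t with hP
  set V : Set ℝ := {r | ∃ x u t, P x u t ∧ r = t + ‖x‖ ^ 2 / 2 + ‖u‖ ^ 2 / 2} with hV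
  have hbdd : BddBelow V := by
    refine ⟨0, ?_⟩
    rintro r ⟨x, u, t, h, rfl⟩
    have h1 := hA.inner_le_of_fitzpatrick_le h
    have h2 := norm_add_sq_real x u
    nlinarith [sq_nonneg ‖x + u‖]
  have hne : V.Nonempty := by
    obtain ⟨x, u, hu⟩ := hA.exists_mem
    refine ⟨_, x, u, inner ℝ x u, fun a b hb => ?_, rfl⟩
    have := hA.1 x a u hu b hb
    simp only [inner_sub_left, inner_sub_right] at this
    linarith
  obtain ⟨r, -, hr, hrV⟩ := exists_seq_tendsto_sInf hne hbdd
  set m := sInf V with hm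
  choose x u t hPn hrn using hrV
  -- The constraint is affine in `(x, u, t)`, so midpoints are admissible; the parallelogram law
  -- then makes minimizing sequences Cauchy.
  have hmid : ∀ i j, ‖x i - x j‖ ^ 2 + ‖u i - u j‖ ^ 2 ≤ 4 * ((r i - m) + (r j - m)) := by
    intro i j
    have hmem : (t i + t j) / 2 + ‖(1 / 2 : ℝ) • (x i + x j)‖ ^ 2 / 2 +
        ‖(1 / 2 : ℝ) • (u i + u j)‖ ^ 2 / 2 ∈ V := by
      refine ⟨_, _, _, fun a b hb => ?_, rfl⟩
      have h1 := hPn i a b hb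
      have h2 := hPn j a b hb
      simp only [real_inner_smul_left, real_inner_smul_right, inner_add_left, inner_add_right]
      linarith
    have h1 := csInf_le hbdd hmem
    rw [← hm, norm_smul, norm_smul, mul_pow, mul_pow] at h1
    norm_num at h1
    have h2 := parallelogram_law_with_norm ℝ (x i) (x j)
    have h3 := parallelogram_law_with_norm ℝ (u i) (u j)
    have h4 := hrn i
    have h5 := hrn j
    nlinarith
  have hcau : ∀ f : ℕ → E, (∀ i j, ‖f i - f j‖ ^ 2 ≤ 4 * ((r i - m) + (r j - m))) →
      CauchySeq f := by
    intro f hf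
    rw [Metric.cauchySeq_iff]
    intro ε hε
    have hev : ∀ᶠ n in Filter.atTop, r n < m + ε ^ 2 / 8 :=
      hr.eventually_lt_const (by linarith [pow_pos hε 2])
    obtain ⟨N, hN⟩ := Filter.eventually_atTop.1 hev
    refine ⟨N, fun i hi j hj => ?_⟩
    rw [dist_eq_norm]
    refine lt_of_pow_lt_pow_left₀ 2 hε.le ?_
    linarith [hf i j, hN i hi, hN j hj]
  obtain ⟨x₀, hx⟩ := cauchySeq_tendsto_of_complete
    (hcau x fun i j => by linarith [hmid i j, sq_nonneg ‖u i - u j‖])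
  obtain ⟨u₀, hu⟩ := cauchySeq_tendsto_of_complete
    (hcau u fun i j => by linarith [hmid i j, sq_nonneg ‖x i - x j‖])
  have ht : Filter.Tendsto t Filter.atTop
      (nhds (m - ‖x₀‖ ^ 2 / 2 - ‖u₀‖ ^ 2 / 2)) := by
    have := (hr.sub ((hx.norm.pow 2).div_const 2)).sub ((hu.norm.pow 2).div_const 2)
    refine this.congr fun n => ?_
    rw [hrn n]
    ring
  refine ⟨x₀, u₀, m - ‖x₀‖ ^ 2 / 2 - ‖u₀‖ ^ 2 / 2, fun a b hb => ?_, fun x' u' t' h => ?_⟩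
  · refine le_of_tendsto_of_tendsto' (((hx.inner (𝕜 := ℝ) tendsto_const_nhds).add
      (tendsto_const_nhds.inner hu)).sub_const _) ht fun n => ?_
    exact hPn n a b hb
  · have := csInf_le hbdd (show _ ∈ V from ⟨x', u', t', h, rfl⟩)
    linarith

/-- First-order optimality of the minimizer, tested towards graph points, puts `(-u₀, -x₀)` in the
graph; testing at that very point forces `x₀ + u₀ = 0`. -/
theorem IsMaximallyMonotone.exists_neg_mem {A : SetValued E E} (hA : IsMaximallyMonotone A) :
    ∃ x, -x ∈ A x := by
  obtain ⟨x₀, u₀, t₀, h₀, hmin⟩ := hA.exists_minimizer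
  have hlow := hA.inner_le_of_fitzpatrick_le h₀
  have hkey : ∀ a, ∀ b ∈ A a, ‖x₀ + u₀‖ ^ 2 ≤ inner ℝ (a + u₀) (b + x₀) := by
    intro a b hb
    set Q := ‖a - x₀‖ ^ 2 / 2 + ‖b - u₀‖ ^ 2 / 2 with hQ
    -- Monotonicity makes `(a, b, ⟪a, b⟫)` admissible, hence so is the segment towards it; `Q` is
    -- the second-order remainder.
    have hs : ∀ s : ℝ, 0 < s → s ≤ 1 →
        0 ≤ (inner ℝ a b - t₀ + inner ℝ x₀ (a - x₀) + inner ℝ u₀ (b - u₀)) + s * Q := by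
      intro s hs0 hs1
      have h1 := hmin (x₀ + s • (a - x₀)) (u₀ + s • (b - u₀)) (t₀ + s * (inner ℝ a b - t₀)) ?_
      · rw [norm_add_sq_real, norm_add_sq_real, norm_smul, norm_smul, mul_pow, mul_pow,
          real_inner_smul_right, real_inner_smul_right, Real.norm_eq_abs, sq_abs] at h1
        refine nonneg_of_mul_nonneg_right ?_ hs0
        rw [hQ]
        linarith
      · intro a' b' hb'
        have h2 := h₀ a' b' hb'
        have h3 := hA.1 a a' b hb b' hb'
        simp only [inner_sub_left, inner_sub_right, inner_add_left, inner_add_right,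
          real_inner_smul_left, real_inner_smul_right] at h3 ⊢
        nlinarith
    have hlim : 0 ≤ inner ℝ a b - t₀ + inner ℝ x₀ (a - x₀) + inner ℝ u₀ (b - u₀) := by
      have hc : Filter.Tendsto (fun s : ℝ =>
          (inner ℝ a b - t₀ + inner ℝ x₀ (a - x₀) + inner ℝ u₀ (b - u₀)) + s * Q)
          (nhdsWithin 0 (Set.Ioi 0))
          (nhds ((inner ℝ a b - t₀ + inner ℝ x₀ (a - x₀) + inner ℝ u₀ (b - u₀)) + 0 * Q)) :=
        ((continuous_const.add (continuous_id.mul continuous_const)).tendsto 0).mono_left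
          nhdsWithin_le_nhds
      rw [zero_mul, add_zero] at hc
      refine ge_of_tendsto hc ?_
      filter_upwards [Ioc_mem_nhdsGT (zero_lt_one' ℝ)] with s hs'
      exact hs s hs'.1 hs'.2
    rw [norm_add_sq_real, ← real_inner_self_eq_norm_sq, ← real_inner_self_eq_norm_sq]
    simp only [inner_sub_right, inner_add_left, inner_add_right] at hlim ⊢
    linarith [real_inner_comm x₀ a, real_inner_comm x₀ u₀]
  have hmem : -x₀ ∈ A (-u₀) := hA.mem_of_related fun a b hb => by
    have := (sq_nonneg _).trans (hkey a b hb)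
    rwa [show -u₀ - a = -(a + u₀) by abel, show -x₀ - b = -(b + x₀) by abel, inner_neg_neg]
  have h1 := hkey _ _ hmem
  rw [neg_add_cancel, inner_zero_left] at h1
  have h2 : x₀ + u₀ = 0 := by
    rw [← norm_eq_zero]
    nlinarith [norm_nonneg (x₀ + u₀)]
  rw [← eq_neg_of_add_eq_zero_left h2] at hmem
  exact ⟨x₀, hmem⟩

/-- **Minty's theorem**: the resolvents of a maximally monotone operator are defined
everywhere. -/
theorem IsMaximallyMonotone.exists_add_smul_eq {A : SetValued E E} (hA : IsMaximallyMonotone A)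
    {τ : ℝ} (hτ : 0 < τ) (z : E) : ∃ x, ∃ u ∈ A x, x + τ • u = z := by
  have hrel : ∀ x a u b : E, inner ℝ (x - a) (τ⁻¹ • (u + z) - τ⁻¹ • (b + z)) =
      τ⁻¹ * inner ℝ (x - a) (u - b) := by
    intro x a u b
    rw [← smul_sub, add_sub_add_right_eq_sub, real_inner_smul_right]
  -- This is the operator `τ A - z`; a point `x` with `-x` in its value solves the equation.
  have hmax : IsMaximallyMonotone (fun x => {u | τ⁻¹ • (u + z) ∈ A x}) := by
    refine IsMonotone.isMaximallyMonotone ?_ ?_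
    · intro x y u hu v hv
      have := hA.1 x y _ hu _ hv
      rw [hrel] at this
      exact nonneg_of_mul_nonneg_right this (inv_pos.2 hτ)
    · intro x u h
      refine hA.mem_of_related fun a b hb => ?_
      have h1 : τ⁻¹ • ((τ • b - z) + z) = b := by
        rw [sub_add_cancel, inv_smul_smul₀ hτ.ne']
      have h2 := hrel x a u (τ • b - z)
      rw [h1] at h2
      rw [h2]
      refine mul_nonneg (inv_pos.2 hτ).le (h a _ ?_)
      rwa [Set.mem_ofPred_eq, h1]
  obtain ⟨x, hx⟩ := hmax.exists_neg_mem
  refine ⟨x, _, hx, ?_⟩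
  rw [smul_inv_smul₀ hτ.ne']
  abel

/-- The sum of a maximally monotone operator and of a Lipschitzian strongly monotone one has
a zero. -/
theorem IsMaximallyMonotone.exists_neg_apply_mem {A : SetValued E E}
    (hA : IsMaximallyMonotone A) {N : E → E} {K : ℝ} (hK : 1 ≤ K)
    (hlip : ∀ x y, ‖N x - N y‖ ≤ K * ‖x - y‖)
    (hmon : ∀ x y, ‖x - y‖ ^ 2 ≤ inner ℝ (N x - N y) (x - y)) : ∃ x, -N x ∈ A x := by
  have hK2 : 0 < K ^ 2 := by positivity
  -- This step size makes the squared Lipschitz constant of `Id - τ N` at most `1 - 2τ + τ²K² = 1 -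
  -- τ`.
  set τ : ℝ := (K ^ 2)⁻¹ with hτ
  have hτ0 : 0 < τ := inv_pos.2 hK2
  have hτ1 : τ ≤ 1 := inv_le_one_of_one_le₀ (one_le_pow₀ hK)
  choose J U hU hJ using hA.exists_add_smul_eq hτ0
  have hne : ∀ w w', ‖J w - J w'‖ ≤ ‖w - w'‖ := by
    intro w w'
    have h1 := hA.1 _ _ _ (hU w) _ (hU w')
    have h2 : w - w' = (J w - J w') + τ • (U w - U w') := by
      rw [smul_sub, ← add_sub_add_comm, hJ, hJ]
    have h3 : ‖J w - J w'‖ ^ 2 ≤ inner ℝ (J w - J w') (w - w') := by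
      rw [h2, inner_add_right, real_inner_smul_right, real_inner_self_eq_norm_sq]
      linarith [mul_nonneg hτ0.le h1]
    have h4 := real_inner_le_norm (J w - J w') (w - w')
    by_contra! hlt
    nlinarith [norm_nonneg (w - w')]
  have hcon : ContractingWith (Real.toNNReal (Real.sqrt (1 - τ)))
      (fun x => J (x - τ • N x)) := by
    refine ⟨?_, LipschitzWith.of_dist_le_mul fun x y => ?_⟩
    · rw [← Real.toNNReal_one, Real.toNNReal_lt_toNNReal_iff zero_lt_one,
        Real.sqrt_lt' zero_lt_one]
      linarith
    · rw [dist_eq_norm, dist_eq_norm, Real.coe_toNNReal _ (Real.sqrt_nonneg _)]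
      refine (hne _ _).trans ?_
      refine le_of_sq_le_sq ?_ (by positivity)
      rw [mul_pow, Real.sq_sqrt (by linarith)]
      have h1 : x - τ • N x - (y - τ • N y) = (x - y) - τ • (N x - N y) := by
        rw [smul_sub]
        abel
      rw [h1, norm_sub_sq_real, norm_smul, mul_pow, real_inner_smul_right, Real.norm_eq_abs,
        sq_abs]
      have h2 := hmon x y
      rw [real_inner_comm] at h2
      have h3 : ‖N x - N y‖ ^ 2 ≤ K ^ 2 * ‖x - y‖ ^ 2 := by
        rw [← mul_pow]
        exact pow_le_pow_left₀ (norm_nonneg _) (hlip x y) 2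
      have h4 : τ ^ 2 * ‖N x - N y‖ ^ 2 ≤ τ * ‖x - y‖ ^ 2 := by
        calc τ ^ 2 * ‖N x - N y‖ ^ 2 ≤ τ ^ 2 * (K ^ 2 * ‖x - y‖ ^ 2) := by gcongr
          _ = τ * (τ * K ^ 2) * ‖x - y‖ ^ 2 := by ring
          _ = τ * ‖x - y‖ ^ 2 := by rw [hτ, inv_mul_cancel₀ hK2.ne', mul_one]
      nlinarith
  set x := hcon.fixedPoint
  have hfix : J (x - τ • N x) = x := hcon.fixedPoint_isFixedPt
  have h1 := hJ (x - τ • N x)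
  have h2 := hU (x - τ • N x)
  rw [hfix] at h1 h2
  refine ⟨x, ?_⟩
  have h3 : U (x - τ • N x) = -N x := by
    refine smul_right_injective E hτ0.ne' (?_ : τ • U (x - τ • N x) = τ • -N x)
    rw [smul_neg]
    exact add_left_cancel (h1.trans (sub_eq_add_neg _ _))
  rwa [h3] at h2

end Minty

end Operators

/-! ### Yosida regularization and passage to the limit. -/

section Composite

variable {E F : Type*}
  [NormedAddCommGroup E] [InnerProductSpace ℝ E] [CompleteSpace E]
  [NormedAddCommGroup F] [InnerProductSpace ℝ F] [CompleteSpace F]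

open ContinuousLinearMap (adjoint)

/-- Solvability of the inclusion `z ∈ x + A x + L* (B_γ (L x))`, where `B_γ` is the Yosida
approximation of `B` of index `γ`. -/
theorem exists_regularized_solution {A : SetValued E E} {B : SetValued F F}
    (hA : IsMaximallyMonotone A) (hB : IsMaximallyMonotone B) (L : E →L[ℝ] F)
    {γ : ℝ} (hγ : 0 < γ) (z : E) :
    ∃ (x u : E) (y v : F), u ∈ A x ∧ v ∈ B y ∧ x + u + adjoint L v = z ∧
      L x = y + γ • v := by
  -- `Y` is the resolvent and `V` the Yosida approximation, which is `γ`-cocoercive.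
  choose Y V hV hY using hB.exists_add_smul_eq hγ
  have hcoc : ∀ w w', γ * ‖V w - V w'‖ ^ 2 ≤ inner ℝ (V w - V w') (w - w') := by
    intro w w'
    have h1 := hB.1 _ _ _ (hV w) _ (hV w')
    have h2 : w - w' = (Y w - Y w') + γ • (V w - V w') := by
      rw [smul_sub, ← add_sub_add_comm, hY, hY]
    rw [h2, inner_add_right, real_inner_smul_right, real_inner_self_eq_norm_sq]
    rw [real_inner_comm] at h1
    linarith
  have hVlip : ∀ w w', ‖V w - V w'‖ ≤ γ⁻¹ * ‖w - w'‖ := by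
    intro w w'
    rw [inv_mul_eq_div, le_div_iff₀ hγ]
    have h1 := (hcoc w w').trans (real_inner_le_norm _ _)
    by_contra! hlt
    nlinarith [norm_nonneg (w - w'), norm_nonneg (V w - V w')]
  have hsub : ∀ x x', (x - z + adjoint L (V (L x))) - (x' - z + adjoint L (V (L x'))) =
      (x - x') + adjoint L (V (L x) - V (L x')) := by
    intro x x'
    rw [map_sub]
    abel
  obtain ⟨x, hx⟩ := hA.exists_neg_apply_mem
    (N := fun x => x - z + adjoint L (V (L x))) (K := 1 + ‖adjoint L‖ * (γ⁻¹ * ‖L‖))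
    (by
      have : 0 ≤ ‖adjoint L‖ * (γ⁻¹ * ‖L‖) := by positivity
      linarith)
    (by
      intro x x'
      rw [hsub, add_mul, one_mul]
      refine (norm_add_le _ _).trans (add_le_add_right ?_ _)
      calc ‖adjoint L (V (L x) - V (L x'))‖
          ≤ ‖adjoint L‖ * ‖V (L x) - V (L x')‖ := (adjoint L).le_opNorm _
        _ ≤ ‖adjoint L‖ * (γ⁻¹ * (‖L‖ * ‖x - x'‖)) := by
            gcongr
            refine (hVlip _ _).trans ?_
            rw [← map_sub]
            gcongr
            exact L.le_opNorm _
        _ = ‖adjoint L‖ * (γ⁻¹ * ‖L‖) * ‖x - x'‖ := by ring)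
    (by
      intro x x'
      rw [hsub, inner_add_left, real_inner_self_eq_norm_sq,
        ContinuousLinearMap.adjoint_inner_left, map_sub]
      have := hcoc (L x) (L x')
      have h2 : 0 ≤ γ * ‖V (L x) - V (L x')‖ ^ 2 := by positivity
      linarith)
  refine ⟨x, _, Y (L x), V (L x), hx, hV _, ?_, (hY _).symm⟩
  abel

/-- A lower bound, which does not depend on the regularized solution `(x, y, u, v)`, for the
inner product of `v` with an element of `L (dom A) - dom B`. -/
theorem neg_le_inner_of_regularized_solution {A : SetValued E E} {B : SetValued F F}
    (hA : IsMonotone A) (hB : IsMonotone B) (L : E →L[ℝ] F)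
    {γ : ℝ} (hγ₀ : 0 ≤ γ) (hγ₁ : γ ≤ 1) {z x u a a' : E} {y v b b' : F}
    (hu : u ∈ A x) (hv : v ∈ B y) (hz : x + u + adjoint L v = z) (hy : L x = y + γ • v)
    (ha : a' ∈ A a) (hb : b' ∈ B b) :
    -(‖z + a - a' - adjoint L b'‖ ^ 2 + ‖b'‖ ^ 2 + |inner ℝ b' b| + |inner ℝ a' a|
      + |inner ℝ z a|) ≤ inner ℝ v (L a - b) := by
  have h1 := hA x a u hu a' ha
  have h2 := hB y b v hv b' hb
  have hu' : u = z - x - adjoint L v := by rw [← hz]; abel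
  have hy' : y = L x - γ • v := by rw [hy]; abel
  rw [hu'] at h1
  rw [hy'] at h2
  -- Completing the square in `x` eliminates it from the sum of `h1` and `h2`.
  have h3 : 0 ≤ ‖z + a - a' - adjoint L b' - x‖ ^ 2 := sq_nonneg _
  rw [norm_sub_sq_real] at h3
  have h4 : γ * inner ℝ v b' ≤ γ * ‖v‖ ^ 2 + ‖b'‖ ^ 2 := by
    have h5 := norm_sub_sq_real v b'
    have h6 : inner ℝ v b' ≤ ‖v‖ ^ 2 + ‖b'‖ ^ 2 := by
      nlinarith [sq_nonneg ‖v - b'‖, sq_nonneg ‖v‖, sq_nonneg ‖b'‖]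
    nlinarith [sq_nonneg ‖b'‖]
  have h5 := real_inner_self_eq_norm_sq x
  have h6 := real_inner_self_eq_norm_sq v
  simp only [inner_sub_left, inner_sub_right, inner_add_left, real_inner_smul_left,
    map_sub, ContinuousLinearMap.adjoint_inner_left, ContinuousLinearMap.adjoint_inner_right] at h1 h2 h3 ⊢
  rw [h6] at h2
  have e1 := real_inner_comm x z
  have e2 := real_inner_comm x a
  have e3 := real_inner_comm x a'
  have e4 := real_inner_comm (L x) v
  have e5 := real_inner_comm (L x) b'
  have e6 := real_inner_comm (L a) v
  have e7 := real_inner_comm b v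
  have e8 := real_inner_comm b b'
  have e9 := real_inner_comm a a'
  have e10 := real_inner_comm a z
  have a1 := abs_le.1 (le_refl |inner ℝ b' b|)
  have a2 := abs_le.1 (le_refl |inner ℝ a' a|)
  have a3 := abs_le.1 (le_refl |inner ℝ z a|)
  have q := sq_nonneg ‖z + a - a' - adjoint L b'‖
  have q' := sq_nonneg ‖x‖
  linarith [a1.1, a1.2, a2.1, a2.2, a3.1, a3.2]

/-- Adding the monotonicity inequalities for `A` and `B` cancels the coupling through `L`; this
compares solutions at two regularization indices. -/
theorem dist_regularized_solutions {A : SetValued E E} {B : SetValued F F}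
    (hA : IsMonotone A) (hB : IsMonotone B) (L : E →L[ℝ] F)
    {γ γ' : ℝ} {z x u x' u' : E} {y v y' v' : F}
    (hu : u ∈ A x) (hv : v ∈ B y) (hz : x + u + adjoint L v = z) (hy : L x = y + γ • v)
    (hu' : u' ∈ A x') (hv' : v' ∈ B y') (hz' : x' + u' + adjoint L v' = z)
    (hy' : L x' = y' + γ' • v') :
    ‖x - x'‖ ^ 2 + inner ℝ (γ • v - γ' • v') (v - v') ≤ 0 := by
  have h1 := hA x x' u hu u' hu'
  have h2 := hB y y' v hv v' hv'
  have e1 : u - u' = -(x - x') - adjoint L (v - v') := by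
    have hu₁ : u = z - x - adjoint L v := by rw [← hz]; abel
    have hu₂ : u' = z - x' - adjoint L v' := by rw [← hz']; abel
    rw [map_sub, hu₁, hu₂]
    abel
  have e2 : L (x - x') = (y - y') + (γ • v - γ' • v') := by
    rw [map_sub, hy, hy']
    abel
  rw [e1, inner_sub_right, inner_neg_right, ContinuousLinearMap.adjoint_inner_right, e2,
    inner_add_left, real_inner_self_eq_norm_sq] at h1
  linarith

/-- If the cone generated by `L (dom A) - dom B` is a closed vector subspace, then
`Id + A + L* ∘ B ∘ L` is surjective. -/
theorem exists_add_add_adjoint_eq {A : SetValued E E} {B : SetValued F F}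
    (hA : IsMaximallyMonotone A) (hB : IsMaximallyMonotone B) (L : E →L[ℝ] F)
    (hS : IsClosedSubspace (coneGenerated (L '' ran (inv A) - ran (inv B)))) (z : E) :
    ∃ x, ∃ u ∈ A x, ∃ v ∈ B (L x), x + u + adjoint L v = z := by
  obtain ⟨S, hSeq, hScl⟩ := hS
  rw [← hSeq] at hScl
  have hmemS : ∀ s, s ∈ S ↔
      s ∈ coneGenerated (L '' ran (inv A) - ran (inv B)) := by
    intro s
    rw [← hSeq]
    rfl
  set γ : ℕ → ℝ := fun n => 1 / ((n : ℝ) + 1) with hγ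
  have hγ0 : ∀ n, 0 < γ n := fun n => Nat.one_div_pos_of_nat
  have hγanti : ∀ n m, n ≤ m → γ m ≤ γ n := fun n m h => Nat.one_div_le_one_div h
  have hγ1 : ∀ n, γ n ≤ 1 := fun n => by
    have := hγanti 0 n (Nat.zero_le n)
    simpa [hγ] using this
  choose x u y v hu hv hz hy using fun n => exists_regularized_solution hA hB L (hγ0 n) z
  have hvS : ∀ n, v n ∈ S := by
    intro n
    rw [hmemS]
    refine ⟨(γ n)⁻¹, inv_pos.2 (hγ0 n), L (x n) - y n,
      Set.sub_mem_sub ⟨x n, ⟨u n, hu n⟩, rfl⟩ ⟨v n, hv n⟩, ?_⟩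
    rw [hy n, add_sub_cancel_left, inv_smul_smul₀ (hγ0 n).ne']
  have hlow : ∀ s ∈ S, ∃ C, ∀ n, -C ≤ inner ℝ (v n) s := by
    intro s hs
    obtain ⟨t, ht, _, ⟨_, ⟨a, ⟨a', ha⟩, rfl⟩, b, ⟨b', hb⟩, rfl⟩, rfl⟩ := (hmemS s).1 hs
    have key := fun n => mul_le_mul_of_nonneg_left (neg_le_inner_of_regularized_solution
      hA.1 hB.1 L (hγ0 n).le (hγ1 n) (hu n) (hv n) (hz n) (hy n) ha hb) ht.le
    exact ⟨_, fun n => le_of_eq_of_le (mul_neg _ _).symm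
      ((key n).trans_eq (real_inner_smul_right _ _ _).symm)⟩
  -- Since `S` contains `-s` along with `s`, the lower bounds become two-sided. Uniform boundedness
  -- on `S` controls `‖v n‖` because `v n` itself lies in `S`.
  have hbound : ∃ M, ∀ n, ‖v n‖ ≤ M := by
    have : CompleteSpace S := hScl.completeSpace_coe
    obtain ⟨M, hM⟩ := banach_steinhaus
      (g := fun n => (innerSL ℝ (v n)).comp S.subtypeL) (by
        intro s
        obtain ⟨C, hC⟩ := hlow s s.2
        obtain ⟨C', hC'⟩ := hlow (-s) (S.neg_mem s.2)
        refine ⟨max C C', fun n => ?_⟩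
        have h1 := hC n
        have h2 := hC' n
        rw [inner_neg_right] at h2
        change |inner ℝ (v n) (s : F)| ≤ _
        rw [abs_le]
        constructor
        · linarith [le_max_left C C']
        · linarith [le_max_right C C'])
    refine ⟨M, fun n => ?_⟩
    have h1 := ((innerSL ℝ (v n)).comp S.subtypeL).le_of_opNorm_le (hM n) ⟨v n, hvS n⟩
    change |inner ℝ (v n) (v n)| ≤ M * ‖v n‖ at h1
    rw [real_inner_self_eq_norm_sq, abs_of_nonneg (sq_nonneg _), sq] at h1
    by_contra! hlt
    have hM0 : 0 ≤ M := (norm_nonneg _).trans (hM n)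
    nlinarith [norm_nonneg (v n)]
  obtain ⟨M, hM⟩ := hbound
  have hM0 : 0 ≤ M := (norm_nonneg _).trans (hM 0)
  have hdist : ∀ n m, ‖x n - x m‖ ^ 2 + inner ℝ (γ n • v n - γ m • v m) (v n - v m) ≤ 0 :=
    fun n m => dist_regularized_solutions hA.1 hB.1 L (hu n) (hv n) (hz n) (hy n)
      (hu m) (hv m) (hz m) (hy m)
  have hvle : ∀ n m, n < m → ‖v n - v m‖ ^ 2 ≤ ‖v m‖ ^ 2 - ‖v n‖ ^ 2 := by
    intro n m hnm
    have hlt : γ m < γ n := Nat.one_div_lt_one_div hnm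
    have h1 := hdist n m
    -- Uses `2⟪γv - γ'v', v - v'⟫ = (γ + γ')‖v - v'‖² + (γ - γ')(‖v‖² - ‖v'‖²)`.
    have h2 : (γ n + γ m) * ‖v n - v m‖ ^ 2 ≤ (γ n - γ m) * (‖v m‖ ^ 2 - ‖v n‖ ^ 2) := by
      have h3 := norm_sub_sq_real (v n) (v m)
      simp only [inner_sub_left, inner_sub_right, real_inner_smul_left,
        real_inner_self_eq_norm_sq] at h1
      rw [real_inner_comm (v n) (v m)] at h1
      rw [h3]
      nlinarith [sq_nonneg ‖x n - x m‖]
    have h4 : 0 ≤ ‖v m‖ ^ 2 - ‖v n‖ ^ 2 := by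
      refine nonneg_of_mul_nonneg_right (le_trans ?_ h2) (sub_pos.2 hlt)
      have := hγ0 n
      have := hγ0 m
      positivity
    have h5 := hγ0 m
    refine le_of_mul_le_mul_left (h2.trans ?_) (add_pos (hγ0 n) (hγ0 m))
    exact mul_le_mul_of_nonneg_right (by linarith) h4
  have hsq : CauchySeq fun n => ‖v n‖ ^ 2 := by
    refine (tendsto_atTop_ciSup (monotone_nat_of_le_succ fun n => ?_) ⟨M ^ 2, ?_⟩).cauchySeq
    · linarith [hvle n (n + 1) n.lt_succ_self, sq_nonneg ‖v n - v (n + 1)‖]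
    · rintro _ ⟨n, rfl⟩
      exact pow_le_pow_left₀ (norm_nonneg _) (hM n) 2
  have hvc : CauchySeq v := by
    refine cauchySeq_of_sq_norm_sub_le (C := 1) hsq fun n m => ?_
    rw [one_mul, Real.dist_eq]
    rcases lt_trichotomy n m with h | rfl | h
    · rw [abs_sub_comm]
      exact (hvle n m h).trans (le_abs_self _)
    · simp
    · rw [norm_sub_rev]
      exact (hvle m n h).trans (le_abs_self _)
  have hxc : CauchySeq x := by
    refine cauchySeq_of_sq_norm_sub_le (C := 2 * M) hvc fun n m => ?_
    rw [dist_eq_norm]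
    have h1 := hdist n m
    have h2 := neg_le_of_abs_le (abs_real_inner_le_norm (γ n • v n - γ m • v m) (v n - v m))
    have hsm : ∀ k, ‖γ k • v k‖ ≤ M := by
      intro k
      rw [norm_smul, Real.norm_of_nonneg (hγ0 k).le]
      nlinarith [hγ1 k, hγ0 k, hM k, norm_nonneg (v k)]
    have h3 : ‖γ n • v n - γ m • v m‖ ≤ 2 * M := by
      linarith [norm_sub_le (γ n • v n) (γ m • v m), hsm n, hsm m]
    nlinarith [norm_nonneg (v n - v m)]
  obtain ⟨v₀, hv₀⟩ := cauchySeq_tendsto_of_complete hvc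
  obtain ⟨x₀, hx₀⟩ := cauchySeq_tendsto_of_complete hxc
  have hγlim : Filter.Tendsto γ Filter.atTop (nhds 0) := tendsto_one_div_add_atTop_nhds_zero_nat
  have hy₀ : Filter.Tendsto y Filter.atTop (nhds (L x₀)) := by
    have h1 := ((L.continuous.tendsto x₀).comp hx₀).sub (hγlim.smul hv₀)
    rw [zero_smul, sub_zero] at h1
    refine h1.congr fun n => ?_
    rw [Function.comp_apply, hy n, add_sub_cancel_right]
  have hu₀ : Filter.Tendsto u Filter.atTop (nhds (z - x₀ - adjoint L v₀)) := by
    have h1 := (hx₀.const_sub z).sub (((adjoint L).continuous.tendsto v₀).comp hv₀)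
    refine h1.congr fun n => ?_
    rw [Function.comp_apply, ← hz n]
    abel
  refine ⟨x₀, _, hA.mem_of_tendsto hu hx₀ hu₀, v₀, hB.mem_of_tendsto hv hy₀ hv₀, ?_⟩
  abel

theorem IsMonotone.comp_adjoint {A : SetValued E E} (hA : IsMonotone A) (L : E →L[ℝ] F) :
    IsMonotone (comp L A (adjoint L)) := by
  rintro x y _ ⟨u, hu, rfl⟩ _ ⟨v, hv, rfl⟩
  rw [← map_sub, ← ContinuousLinearMap.adjoint_inner_left, map_sub]
  exact hA _ _ u hu v hv

theorem inv_parallelSum_parallelComp (A : SetValued E E) (B : SetValued F F) (L : E →L[ℝ] F) :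
    inv (parallelSum (parallelComp L A) B) =
      sum (comp L (inv A) (adjoint L)) (inv B) :=
  rfl

theorem IsMaximallyMonotone.sum_comp_adjoint {A : SetValued E E} {B : SetValued F F}
    (hA : IsMaximallyMonotone A) (hB : IsMaximallyMonotone B) (L : E →L[ℝ] F)
    (hS : IsClosedSubspace (coneGenerated
      (adjoint L '' ran (SetValued.inv B) - ran (SetValued.inv A)))) :
    IsMaximallyMonotone (sum (comp L A (adjoint L)) B) := by
  refine ((hA.1.comp_adjoint L).sum hB.1).isMaximallyMonotone_of_surjective fun z => ?_
  -- The roles are exchanged: `B` acts on the base space and `A` is composed with `adjoint L`.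
  obtain ⟨x, u, hu, v, hv, h⟩ := exists_add_add_adjoint_eq hB hA (adjoint L) hS z
  rw [ContinuousLinearMap.adjoint_adjoint] at h
  refine ⟨x, L v + u, Set.add_mem_add ⟨v, hv, rfl⟩ hu, ?_⟩
  rw [← h]
  abel

end Composite

end SetValued

theorem lemma2p2 {H G : Type*}
    [NormedAddCommGroup H] [InnerProductSpace ℝ H] [CompleteSpace H]
    [NormedAddCommGroup G] [InnerProductSpace ℝ G] [CompleteSpace G]
    (A : SetValued H H) (B : SetValued G G) (L : H →L[ℝ] G) :
    SetValued.inv (SetValued.parallelSum (SetValued.parallelComp L A) B) =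
        SetValued.sum
          (SetValued.comp L (SetValued.inv A) (ContinuousLinearMap.adjoint L))
          (SetValued.inv B) ∧
    (SetValued.IsMonotone A → SetValued.IsMonotone B →
      SetValued.IsMonotone (SetValued.parallelSum (SetValued.parallelComp L A) B)) ∧
    (SetValued.IsMaximallyMonotone A → SetValued.IsMaximallyMonotone B →
      SetValued.IsClosedSubspace (SetValued.coneGenerated
        (ContinuousLinearMap.adjoint L '' SetValued.ran B - SetValued.ran A)) →
      SetValued.IsMaximallyMonotone
        (SetValued.parallelSum (SetValued.parallelComp L A) B)) ∧
    (SetValued.IsMaximallyMonotone A →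
      SetValued.IsClosedSubspace (SetValued.coneGenerated
        (Set.range (ContinuousLinearMap.adjoint L) + SetValued.ran A)) →
      SetValued.IsMaximallyMonotone (SetValued.parallelComp L A)) := by
  refine ⟨SetValued.inv_parallelSum_parallelComp A B L, fun hA hB => ?_, fun hA hB hS => ?_, fun hA hS => ?_⟩
  · exact ((hA.inv.comp_adjoint L).sum hB.inv).inv
  · exact (hA.inv.sum_comp_adjoint hB.inv L hS).inv
  -- The zero operator plays the part of `B⁻¹`; the resulting cone is the given one up to sign.
  · have hcone : ContinuousLinearMap.adjoint L ''
          SetValued.ran (SetValued.inv fun _ : G => ({0} : Set G)) - SetValued.ran A =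
        -(Set.range (ContinuousLinearMap.adjoint L) + SetValued.ran A) := by
      have hran : SetValued.ran (SetValued.inv fun _ : G => ({0} : Set G)) = Set.univ :=
        Set.eq_univ_of_forall fun y => ⟨0, rfl⟩
      have hneg : -Set.range (ContinuousLinearMap.adjoint L) =
          Set.range (ContinuousLinearMap.adjoint L) := by
        ext y
        constructor
        · rintro ⟨w, hw⟩
          exact ⟨-w, by rw [map_neg, hw, neg_neg]⟩
        · rintro ⟨w, rfl⟩
          exact ⟨-w, map_neg _ w⟩
      rw [hran, Set.image_univ, neg_add, hneg, sub_eq_add_neg]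
    have h0 := SetValued.IsMaximallyMonotone.sum_comp_adjoint hA.inv
      SetValued.isMaximallyMonotone_zero L (by
        change SetValued.IsClosedSubspace (SetValued.coneGenerated (_ - SetValued.ran A))
        rw [hcone, SetValued.coneGenerated_neg]
        exact hS.neg)
    have hsum : SetValued.sum
        (SetValued.comp L (SetValued.inv A) (ContinuousLinearMap.adjoint L))
        (fun _ : G => ({0} : Set G)) =
        SetValued.comp L (SetValued.inv A) (ContinuousLinearMap.adjoint L) :=
      funext fun y => add_zero (_ : Set G)
    rw [hsum] at h0
    exact h0.inv
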